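/- Let $\mathcal H=\{(x,v)\in\mathbb R^2: v\ge 0\}$, and let $d_H$ be the Riemannian (Heston) distance generated by the metric $ds^2=v^{-1}(dx^2+dv^2)$: $d_H(A,B)$ is the infimum of the lengths $\int_0^1\sqrt{(\dot x^2+\dot v^2)/v}\,dt$ over all $C^1$ curves $t\mapsto(x(t),v(t))$, $t\in[0,1]$, from $A$ to $B$ with $v(t)>0$ for $0<t<1$. Let $d_G$ be the Carnot–Carathéodory distance on $\mathbb R^2$ (the Grushin plane) for which the vector fields $y\,\partial_x$ and $\tfrac12\partial_y$ form an orthonormal frame. **Theorem.** Let $(x_0,v_0),(x_1,v_1)\in\mathcal H$, not both on the boundary $\{v=0\}$. Then the equation $$\frac{(v_1+v_0)(\delta-\sin\delta)-2\sqrt{v_1v_0}\left(\delta\cos\frac{\delta}{2}-2\sin\frac{\delta}{2}\right)}{2\sin^2\frac{\delta}{2}}=x_1-x_0$$ has a unique solution $\hat\delta$ with $-2\pi<\hat\delta<2\pi$, the distance $d_H((x_0,v_0),(x_1,v_1))$ is finite, and $$d_H\left((x_0,v_0),(x_1,v_1)\right)=\frac{\hat\delta}{\sin\frac{\hat\delta}{2}}\sqrt{v_1+v_0-2\sqrt{v_0v_1}\cos\frac{\hat\delta}{2}}.$$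 Moreover $d_G((x_0,\sqrt{v_0}),(x_1,\sqrt{v_1}))=d_H((x_0,v_0),(x_1,v_1))$, so the same formula gives the Grushin distance. At $\delta=0$ the left-hand side of the equation and the factor $\delta/\sin(\delta/2)$ are understood as their limits $0$ and $2$; the solution $\hat\delta=0$ occurs exactly when $x_0=x_1$. -/

import Mathlib

open scoped ENNReal

noncomputable section

/-- The closed half-plane `ℋ = {(x, v) : v ≥ 0}`. -/
def hestonHalfPlane : Set (ℝ × ℝ) := {p | 0 ≤ p.2}

/-- `γ`, restricted to `[0, 1]`, is a `C¹` curve from `A` to `B` which stays in the open half-plane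
`{v > 0}`, except that its end points may lie on the boundary (if `A` or `B` does). For `A` and `B`
in the open half-plane these are exactly the `C¹` curves of the open half-plane. -/
structure IsHestonCurve (A B : ℝ × ℝ) (γ : ℝ → ℝ × ℝ) : Prop where
  contDiffOn : ContDiffOn ℝ 1 γ (Set.Icc 0 1)
  source : γ 0 = A
  target : γ 1 = B
  interior : ∀ t ∈ Set.Ioo (0 : ℝ) 1, 0 < (γ t).2

/-- The length of a curve for the metric `ds² = v⁻¹ (dx² + dv²)`. -/
def hestonLength (γ : ℝ → ℝ × ℝ) : ℝ≥0∞ :=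
  ∫⁻ t in Set.Icc (0 : ℝ) 1, ENNReal.ofReal
    (Real.sqrt (((derivWithin γ (Set.Icc 0 1) t).1 ^ 2 + (derivWithin γ (Set.Icc 0 1) t).2 ^ 2)
      / (γ t).2))

/-- The Heston distance with values in `[0, ∞]`: the infimum of the lengths of the curves from
`A` to `B`. -/
def hestonEDist (A B : ℝ × ℝ) : ℝ≥0∞ :=
  ⨅ (γ : ℝ → ℝ × ℝ) (_ : IsHestonCurve A B γ), hestonLength γ

/-- The Heston distance as a real number. -/
def hestonDist (A B : ℝ × ℝ) : ℝ := (hestonEDist A B).toReal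

/-- The sub-Riemannian norm of the tangent vector `w` at the point `p = (x, y)` of the Grushin plane
whose distribution is spanned by the orthonormal frame `y ∂/∂x`, `(1/2) ∂/∂y`: the least Euclidean
norm of the coefficients `(a, b)` representing `w`; it is `∞` if `w` is not horizontal. -/
def grushinENorm (p w : ℝ × ℝ) : ℝ≥0∞ :=
  ⨅ (a : ℝ) (b : ℝ) (_ : w = (a * p.2, b / 2)), ENNReal.ofReal (Real.sqrt (a ^ 2 + b ^ 2))

/-- The Carnot-Carathéodory distance of the Grushin plane: the infimum of the sub-Riemannian lengths
of the `C¹` curves from `P` to `Q` in `ℝ²` (curves that are not horizontal almost everywhere have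
infinite length). -/
def grushinEDist (P Q : ℝ × ℝ) : ℝ≥0∞ :=
  ⨅ (γ : ℝ → ℝ × ℝ) (_ : ContDiffOn ℝ 1 γ (Set.Icc 0 1) ∧ γ 0 = P ∧ γ 1 = Q),
    ∫⁻ t in Set.Icc (0 : ℝ) 1, grushinENorm (γ t) (derivWithin γ (Set.Icc 0 1) t)

/-- The left-hand side of the transcendental equation for `δ ∈ (-2π, 2π)`. The singularity at
`δ = 0` is removable, and the value there is the limit `0`. -/
def deltaFun (v₀ v₁ δ : ℝ) : ℝ :=
  if δ = 0 then 0
  else ((v₁ + v₀) * (δ - Real.sin δ)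
      - 2 * Real.sqrt (v₁ * v₀) * (δ * Real.cos (δ / 2) - 2 * Real.sin (δ / 2)))
    / (2 * Real.sin (δ / 2) ^ 2)

/-- The factor `δ / sin (δ / 2)` for `δ ∈ (-2π, 2π)`, with its limit `2` as the value at `δ = 0`. -/
def deltaFactor (δ : ℝ) : ℝ :=
  if δ = 0 then 2 else δ / Real.sin (δ / 2)

end

/-! The substitution `v = y²` turns the Heston metric into the Grushin metric `dx²/y² + 4 dy²`. Its
geodesics satisfy `Y'' = -k² Y`, `X' = 2kY²`, with `k = δ/2`, and have constant speed `2√C`, where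
`C = Y'² + k²Y²`. Solving this with prescribed `y₀, y₁` gives `X 1 - X 0 = deltaFun`, so the
transcendental equation is the endpoint condition in `x`, and `2√C` is the claimed distance
(`exists_isGrushinGeodesic`). Monotonicity and the limits of `deltaFun` give a unique `δ`.

Minimality is proved by calibration. The function `4kx + grushinCalibration k Y Z t y` solves the
Hamilton–Jacobi equation of the squared speed, so along a curve of length `ℓ` traversed at constant
speed in unit time it grows by at most `ℓ²`; along the geodesic it grows by exactly `4C`. Hence `ℓ ≥
2√C`. The condition `|k| < π` is what keeps the Riccati coefficient of the calibration finite on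
`[0, 1]`.

The Grushin metric is singular on `y = 0` and `√v` is not smooth at `v = 0`; both are handled by an
`ε`-regularization and a limit (`calibration_le`, `lintegral_grushinENorm_sqrt_le`). -/

/-! ### Grushin geodesics and upper bounds for the two distances -/

theorem harmonic_energy_eq {k : ℝ} {Y Z : ℝ → ℝ} (hY : ∀ t, HasDerivAt Y (Z t) t)
    (hZ : ∀ t, HasDerivAt Z (-k ^ 2 * Y t) t) (t : ℝ) :
    Z t ^ 2 + k ^ 2 * Y t ^ 2 = Z 0 ^ 2 + k ^ 2 * Y 0 ^ 2 := by
  have hd : ∀ s, HasDerivAt (fun s => Z s ^ 2 + k ^ 2 * Y s ^ 2) 0 s := fun s => by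
    refine (((hZ s).fun_pow 2).fun_add (((hY s).fun_pow 2).const_mul (k ^ 2))).congr_deriv ?_
    norm_num
    ring
  exact is_const_of_deriv_eq_zero (fun s => (hd s).differentiableAt) (fun s => (hd s).deriv) t 0

/-- `(X, Y)` is a normal geodesic of the Grushin plane, parametrized proportionally to arc length,
with `Z = Y'` and vertical momentum `2k`. -/
structure IsGrushinGeodesic (k : ℝ) (X Y Z : ℝ → ℝ) : Prop where
  hasDerivAt_x : ∀ t, HasDerivAt X (2 * k * Y t ^ 2) t
  hasDerivAt_y : ∀ t, HasDerivAt Y (Z t) t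
  hasDerivAt_z : ∀ t, HasDerivAt Z (-k ^ 2 * Y t) t

namespace IsGrushinGeodesic

variable {k : ℝ} {X Y Z : ℝ → ℝ}

theorem energy_eq (h : IsGrushinGeodesic k X Y Z) (t : ℝ) :
    Z t ^ 2 + k ^ 2 * Y t ^ 2 = Z 0 ^ 2 + k ^ 2 * Y 0 ^ 2 :=
  harmonic_energy_eq h.hasDerivAt_y h.hasDerivAt_z t

/-- By the equations of motion `(kX + ZY)' = Z² + k²Y²`, which is the conserved energy. This
evaluates the calibration along the geodesic. -/
theorem action_eq (h : IsGrushinGeodesic k X Y Z) :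
    k * (X 1 - X 0) + (Z 1 * Y 1 - Z 0 * Y 0) = Z 0 ^ 2 + k ^ 2 * Y 0 ^ 2 := by
  have hd : ∀ s, HasDerivAt
      (fun s => k * X s + Z s * Y s - (Z 0 ^ 2 + k ^ 2 * Y 0 ^ 2) * s) 0 s := fun s => by
    refine ((((h.hasDerivAt_x s).const_mul k).fun_add
      ((h.hasDerivAt_z s).fun_mul (h.hasDerivAt_y s))).fun_sub
      ((hasDerivAt_id' s).const_mul (Z 0 ^ 2 + k ^ 2 * Y 0 ^ 2))).congr_deriv ?_
    rw [← h.energy_eq s]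
    ring
  have := is_const_of_deriv_eq_zero (fun s => (hd s).differentiableAt) (fun s => (hd s).deriv) 1 0
  linarith

theorem contDiff_z (h : IsGrushinGeodesic k X Y Z) : ContDiff ℝ 1 Z := by
  rw [contDiff_one_iff_deriv]
  refine ⟨fun t => (h.hasDerivAt_z t).differentiableAt, ?_⟩
  have : deriv Z = fun t => -k ^ 2 * Y t := funext fun t => (h.hasDerivAt_z t).deriv
  rw [this]
  exact continuous_const.mul
    (continuous_iff_continuousAt.2 fun t => (h.hasDerivAt_y t).continuousAt)

theorem contDiff_y (h : IsGrushinGeodesic k X Y Z) : ContDiff ℝ 1 Y := by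
  rw [contDiff_one_iff_deriv]
  refine ⟨fun t => (h.hasDerivAt_y t).differentiableAt, ?_⟩
  have : deriv Y = Z := funext fun t => (h.hasDerivAt_y t).deriv
  rw [this]
  exact h.contDiff_z.continuous

theorem contDiff_x (h : IsGrushinGeodesic k X Y Z) : ContDiff ℝ 1 X := by
  rw [contDiff_one_iff_deriv]
  refine ⟨fun t => (h.hasDerivAt_x t).differentiableAt, ?_⟩
  have : deriv X = fun t => 2 * k * Y t ^ 2 := funext fun t => (h.hasDerivAt_x t).deriv
  rw [this]
  exact continuous_const.mul (h.contDiff_y.continuous.pow 2)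

theorem grushinEDist_le (h : IsGrushinGeodesic k X Y Z) :
    grushinEDist (X 0, Y 0) (X 1, Y 1) ≤
      ENNReal.ofReal (2 * √(Z 0 ^ 2 + k ^ 2 * Y 0 ^ 2)) := by
  refine (iInf₂_le (fun t => (X t, Y t))
    ⟨(h.contDiff_x.prodMk h.contDiff_y).contDiffOn, rfl, rfl⟩).trans ?_
  calc _ ≤ ∫⁻ _ in Set.Icc (0 : ℝ) 1, ENNReal.ofReal (2 * √(Z 0 ^ 2 + k ^ 2 * Y 0 ^ 2)) := by
        refine MeasureTheory.setLIntegral_mono measurable_const fun t ht => ?_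
        rw [((h.hasDerivAt_x t).prodMk (h.hasDerivAt_y t)).hasDerivWithinAt.derivWithin
          (uniqueDiffOn_Icc one_pos t ht)]
        refine (iInf₂_le (2 * k * Y t) (2 * Z t)).trans ((iInf_le _ ?_).trans ?_)
        · ext <;> simp <;> ring
        · refine ENNReal.ofReal_le_ofReal (Real.sqrt_le_iff.2 ⟨by positivity, ?_⟩)
          rw [mul_pow 2 (√_), Real.sq_sqrt (by positivity), ← h.energy_eq t]
          exact le_of_eq (by ring)
    _ = _ := by simp

theorem hestonEDist_le (h : IsGrushinGeodesic k X Y Z) (hY : ∀ t ∈ Set.Ioo (0 : ℝ) 1, 0 < Y t) :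
    hestonEDist (X 0, Y 0 ^ 2) (X 1, Y 1 ^ 2) ≤
      ENNReal.ofReal (2 * √(Z 0 ^ 2 + k ^ 2 * Y 0 ^ 2)) := by
  refine (iInf₂_le (fun t => (X t, Y t ^ 2))
    ⟨(h.contDiff_x.prodMk (h.contDiff_y.pow 2)).contDiffOn, rfl, rfl,
      fun t ht => pow_pos (hY t ht) 2⟩).trans ?_
  calc _ ≤ ∫⁻ _ in Set.Icc (0 : ℝ) 1, ENNReal.ofReal (2 * √(Z 0 ^ 2 + k ^ 2 * Y 0 ^ 2)) := by
        refine MeasureTheory.setLIntegral_mono measurable_const fun t ht => ?_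
        rw [((h.hasDerivAt_x t).prodMk
          ((h.hasDerivAt_y t).fun_pow 2)).hasDerivWithinAt.derivWithin
          (uniqueDiffOn_Icc one_pos t ht)]
        refine ENNReal.ofReal_le_ofReal (Real.sqrt_le_iff.2 ⟨by positivity, ?_⟩)
        rw [mul_pow 2 (√_), Real.sq_sqrt (by positivity), ← h.energy_eq t]
        -- On the boundary the quotient by `v = 0` is `0` by convention, so the bound is trivial
        -- there.
        rcases eq_or_ne (Y t) 0 with h0 | h0
        · simp [h0]
          positivity
        · rw [div_le_iff₀ (pow_pos (abs_pos.2 h0) 2 |>.trans_eq (sq_abs _))]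
          norm_num
          exact le_of_eq (by ring)
    _ = _ := by simp

end IsGrushinGeodesic

/-! ### The calibration -/

/-- The solution of the Riccati equation `φ' = -(k² + φ²)` that vanishes at `1 / 2`. -/
noncomputable def grushinRiccati (k t : ℝ) : ℝ := -k * Real.tan (k * (t - 1 / 2))

theorem hasDerivAt_grushinRiccati {k t : ℝ} (hk : |k| < Real.pi) (ht : t ∈ Set.Icc (0 : ℝ) 1) :
    HasDerivAt (grushinRiccati k) (-(k ^ 2 + grushinRiccati k t ^ 2)) t := by
  -- Centring the tangent at `1 / 2` makes the interval free of poles as long as possible: exactly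
  -- for `|k| < π`.
  have habs : |k * (t - 1 / 2)| < Real.pi / 2 := by
    rw [abs_mul]
    have h2 : |t - 1 / 2| ≤ 1 / 2 := abs_le.2 ⟨by linarith [ht.1], by linarith [ht.2]⟩
    nlinarith [abs_nonneg k]
  have hc : Real.cos (k * (t - 1 / 2)) ≠ 0 := (Real.cos_pos_of_mem_Ioo (abs_lt.1 habs)).ne'
  have hin : HasDerivAt (fun s : ℝ => k * (s - 1 / 2)) k t := by
    exact (((hasDerivAt_id' t).sub_const (1 / 2)).const_mul k).congr_deriv (mul_one k)
  have := ((Real.hasDerivAt_tan hc).comp t hin).const_mul (-k)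
  refine this.congr_deriv ?_
  unfold grushinRiccati
  rw [Real.tan_eq_sin_div_cos]
  generalize k * (t - 1 / 2) = u at hc
  field_simp
  linear_combination (k ^ 2) * Real.sin_sq_add_cos_sq u

/-- The time-dependent calibration attached to a geodesic. -/
noncomputable def grushinCalibration (k : ℝ) (Y Z : ℝ → ℝ) (t y : ℝ) : ℝ :=
  4 * (2 * Z t * y - Z t * Y t + grushinRiccati k t * (y - Y t) ^ 2)

theorem continuous_grushinCalibration (k : ℝ) (Y Z : ℝ → ℝ) (t : ℝ) :
    Continuous (grushinCalibration k Y Z t) := by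
  unfold grushinCalibration
  fun_prop

theorem grushinCalibration_self (k : ℝ) (Y Z : ℝ → ℝ) (t : ℝ) :
    grushinCalibration k Y Z t (Y t) = 4 * (Z t * Y t) := by
  unfold grushinCalibration
  ring

namespace IsGrushinGeodesic

variable {k : ℝ} {X Y Z : ℝ → ℝ}

/-- With `p = Z + φ(y - Y)`, where `φ` is the Riccati solution, the calibration has `y`-derivative
`8p` and time derivative `-4(k²y² + p²)`. The latter is the Hamilton–Jacobi equation, and holds
because `φ' = -(k² + φ²)`. -/
theorem hasDerivAt_calibration (h : IsGrushinGeodesic k X Y Z) (hk : |k| < Real.pi)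
    {y τ : ℝ → ℝ} {y' τ' t : ℝ} (hy : HasDerivAt y y' t) (hτ : HasDerivAt τ τ' t)
    (hτt : τ t ∈ Set.Icc (0 : ℝ) 1) :
    HasDerivAt (fun s => grushinCalibration k Y Z (τ s) (y s))
      (4 * (2 * (Z (τ t) + grushinRiccati k (τ t) * (y t - Y (τ t))) * y'
        - (k ^ 2 * y t ^ 2 + (Z (τ t) + grushinRiccati k (τ t) * (y t - Y (τ t))) ^ 2) * τ')) t := by
  have hY := (h.hasDerivAt_y (τ t)).comp t hτ
  have hZ := (h.hasDerivAt_z (τ t)).comp t hτ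
  have hφ := (hasDerivAt_grushinRiccati hk hτt).comp t hτ
  have := ((((hZ.const_mul 2).fun_mul hy).fun_sub (hZ.fun_mul hY)).fun_add
    (hφ.fun_mul ((hy.fun_sub hY).fun_pow 2))).const_mul 4
  refine this.congr_deriv ?_
  simp only [Function.comp]
  norm_num
  ring

/-- The infinitesimal calibration inequality, for a curve traversed at relative speed `c`. -/
theorem calibration_inequality {k y x' y' p ε ℓ c f : ℝ} (hε : 0 < ε) (hf : 0 < f) (hℓ : 0 < ℓ)
    (hc : c = f / ℓ) (hff : f ^ 2 = x' ^ 2 / (y ^ 2 + ε ^ 2) + 4 * y' ^ 2 + ε ^ 2) :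
    4 * k * x' + 4 * (2 * p * y' - (k ^ 2 * y ^ 2 + p ^ 2) * c) ≤
      (ℓ ^ 2 + 4 * k ^ 2 * ε ^ 2) * c := by
  have hc0 : 0 < c := by rw [hc]; positivity
  have hf' : f = c * ℓ := by rw [hc]; field_simp
  have hw : 0 < y ^ 2 + ε ^ 2 := by positivity
  set w := y ^ 2 + ε ^ 2 with hw'
  -- After multiplication by `c`, the claim is Young's inequality in each direction: the squares
  -- `h1` and `h3` absorb the cross terms in `x'` and `y'`, and `f = cℓ`.
  refine le_of_mul_le_mul_right ?_ hc0
  have h1 : 0 ≤ (x' - 2 * k * w * c) ^ 2 / w := by positivity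
  have h2 : (x' - 2 * k * w * c) ^ 2 / w = x' ^ 2 / w - 4 * k * x' * c + 4 * k ^ 2 * w * c ^ 2 := by
    field_simp
    ring
  rw [hf'] at hff
  have h3 := sq_nonneg (2 * y' - 2 * p * c)
  have h4 : 0 ≤ ε ^ 2 := sq_nonneg ε
  have h5 : 4 * k ^ 2 * w * c ^ 2 = 4 * k ^ 2 * y ^ 2 * c ^ 2 + 4 * k ^ 2 * ε ^ 2 * c ^ 2 := by
    rw [hw']; ring
  nlinarith

/-- Time in the calibration is replaced by the normalized arc length `τ`, and the infinitesimal
inequality is integrated. The `ε²` in the denominator keeps the speed finite where `y = 0`; the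
added `ε²` keeps it positive where the curve rests. -/
theorem calibration_le (h : IsGrushinGeodesic k X Y Z) (hk : |k| < Real.pi)
    {x y x' y' : ℝ → ℝ} (hx : ContinuousOn x (Set.Icc 0 1)) (hy : ContinuousOn y (Set.Icc 0 1))
    (hx' : ContinuousOn x' (Set.Icc 0 1)) (hy' : ContinuousOn y' (Set.Icc 0 1))
    (hdx : ∀ t ∈ Set.Ioo (0 : ℝ) 1, HasDerivAt x (x' t) t)
    (hdy : ∀ t ∈ Set.Ioo (0 : ℝ) 1, HasDerivAt y (y' t) t) {ε : ℝ} (hε : 0 < ε) :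
    4 * k * (x 1 - x 0) + (grushinCalibration k Y Z 1 (y 1) - grushinCalibration k Y Z 0 (y 0)) ≤
      (∫ t in (0 : ℝ)..1, √(x' t ^ 2 / (y t ^ 2 + ε ^ 2) + 4 * y' t ^ 2 + ε ^ 2)) ^ 2
        + 4 * k ^ 2 * ε ^ 2 := by
  set f : ℝ → ℝ := fun t => √(x' t ^ 2 / (y t ^ 2 + ε ^ 2) + 4 * y' t ^ 2 + ε ^ 2) with hf
  have hfc : ContinuousOn f (Set.Icc 0 1) := by
    refine ContinuousOn.sqrt ((((hx'.pow 2).div ((hy.pow 2).add continuousOn_const) ?_).add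
      (continuousOn_const.mul (hy'.pow 2))).add continuousOn_const)
    exact fun t _ => (add_pos_of_nonneg_of_pos (sq_nonneg _) (pow_pos hε 2)).ne'
  have hfpos : ∀ t, 0 < f t := fun t => Real.sqrt_pos.2 (by positivity)
  have hfi : IntervalIntegrable f MeasureTheory.volume 0 1 :=
    ContinuousOn.intervalIntegrable (by rwa [Set.uIcc_of_le zero_le_one])
  have hsub : ∀ t ∈ Set.Icc (0 : ℝ) 1, IntervalIntegrable f MeasureTheory.volume 0 t :=
    fun t ht => hfi.mono_set (by
      rw [Set.uIcc_of_le zero_le_one, Set.uIcc_of_le ht.1]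
      exact Set.Icc_subset_Icc_right ht.2)
  set ℓ := ∫ t in (0 : ℝ)..1, f t with hℓdef
  have hℓ : 0 < ℓ :=
    intervalIntegral.intervalIntegral_pos_of_pos hfi hfpos one_pos
  set τ : ℝ → ℝ := fun t => (∫ s in (0 : ℝ)..t, f s) / ℓ with hτdef
  have hτ0 : τ 0 = 0 := by simp [hτdef]
  have hτ1 : τ 1 = 1 := by simp [hτdef, ← hℓdef, hℓ.ne']
  have hτmem : ∀ t ∈ Set.Icc (0 : ℝ) 1, τ t ∈ Set.Icc (0 : ℝ) 1 := fun t ht => by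
    have h1 : 0 ≤ ∫ s in (0 : ℝ)..t, f s :=
      intervalIntegral.integral_nonneg ht.1 fun s _ => (hfpos s).le
    refine ⟨div_nonneg h1 hℓ.le, (div_le_one hℓ).2 ?_⟩
    exact intervalIntegral.integral_mono_interval le_rfl ht.1 ht.2
      (Filter.Eventually.of_forall fun s => (hfpos s).le) hfi
  have hτd : ∀ t ∈ Set.Ioo (0 : ℝ) 1, HasDerivAt τ (f t / ℓ) t := fun t ht => by
    refine HasDerivAt.div_const ?_ ℓ
    have hnhds : Set.Icc (0 : ℝ) 1 ∈ nhds t := Icc_mem_nhds ht.1 ht.2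
    exact intervalIntegral.integral_hasDerivAt_right (hsub t ⟨ht.1.le, ht.2.le⟩)
      (hfc.stronglyMeasurableAtFilter_nhdsWithin measurableSet_Icc t |>.filter_mono
        (by rw [nhdsWithin_eq_nhds.2 hnhds]))
      (hfc.continuousAt hnhds)
  have hτc : ContinuousOn τ (Set.Icc 0 1) := by
    refine ContinuousOn.div_const ?_ ℓ
    have := intervalIntegral.continuousOn_primitive_interval (a := (0 : ℝ)) (b := 1)
      (f := f) (μ := MeasureTheory.volume) (by
        rw [Set.uIcc_of_le zero_le_one]
        exact hfc.integrableOn_Icc)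
    rwa [Set.uIcc_of_le zero_le_one] at this
  have hYc : Continuous Y := h.contDiff_y.continuous
  have hZc : Continuous Z := h.contDiff_z.continuous
  have hφc : ContinuousOn (fun t => grushinRiccati k (τ t)) (Set.Icc 0 1) :=
    ContinuousOn.comp (g := grushinRiccati k) (t := Set.Icc 0 1)
      (fun t ht => (hasDerivAt_grushinRiccati hk ht).continuousAt.continuousWithinAt) hτc hτmem
  have hanti : AntitoneOn (fun t => 4 * k * x t + grushinCalibration k Y Z (τ t) (y t)
      - (ℓ ^ 2 + 4 * k ^ 2 * ε ^ 2) * τ t) (Set.Icc 0 1) := by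
    have hYτ := hYc.comp_continuousOn hτc
    have hZτ := hZc.comp_continuousOn hτc
    refine antitoneOn_of_hasDerivWithinAt_nonpos (convex_Icc 0 1) ?_
      (f' := fun t => 4 * k * x' t +
        4 * (2 * (Z (τ t) + grushinRiccati k (τ t) * (y t - Y (τ t))) * y' t
        - (k ^ 2 * y t ^ 2 + (Z (τ t) + grushinRiccati k (τ t) * (y t - Y (τ t))) ^ 2)
          * (f t / ℓ)) - (ℓ ^ 2 + 4 * k ^ 2 * ε ^ 2) * (f t / ℓ)) ?_ ?_
    · unfold grushinCalibration
      exact ((continuousOn_const.mul hx).add (continuousOn_const.mul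
        ((((continuousOn_const.mul hZτ).mul hy).sub (hZτ.mul hYτ)).add
          (hφc.mul ((hy.sub hYτ).pow 2))))).sub (continuousOn_const.mul hτc)
    · intro t ht
      rw [interior_Icc] at ht
      exact ((((hdx t ht).const_mul (4 * k)).fun_add
        (h.hasDerivAt_calibration hk (hdy t ht) (hτd t ht)
          (hτmem t ⟨ht.1.le, ht.2.le⟩))).fun_sub
        ((hτd t ht).const_mul (ℓ ^ 2 + 4 * k ^ 2 * ε ^ 2))).hasDerivWithinAt
    · intro t ht
      refine sub_nonpos.2 (calibration_inequality hε (hfpos t) hℓ rfl ?_)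
      rw [hf]
      exact Real.sq_sqrt (by positivity)
  have := hanti (Set.left_mem_Icc.2 zero_le_one) (Set.right_mem_Icc.2 zero_le_one) zero_le_one
  simp only [hτ0, hτ1] at this
  linarith

end IsGrushinGeodesic

/-! ### Unique solvability of the transcendental equation -/

/-- `deltaFun` in terms of the half angle, with `V = v₀ + v₁` and `m = √(v₀ v₁)`. -/
noncomputable def halfDeltaFun (V m k : ℝ) : ℝ :=
  (V * (k - Real.sin k * Real.cos k) + 2 * m * (Real.sin k - k * Real.cos k)) / Real.sin k ^ 2

theorem deltaFun_two_mul (v₀ v₁ : ℝ) {k : ℝ} (hk : k ≠ 0) :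
    deltaFun v₀ v₁ (2 * k) = halfDeltaFun (v₁ + v₀) √(v₁ * v₀) k := by
  unfold deltaFun halfDeltaFun
  rw [if_neg (by simpa using hk), show 2 * k / 2 = k by ring, Real.sin_two_mul]
  rw [← mul_div_mul_left _ (Real.sin k ^ 2) two_ne_zero]
  congr 1
  ring

theorem deltaFun_neg (v₀ v₁ δ : ℝ) : deltaFun v₀ v₁ (-δ) = -deltaFun v₀ v₁ δ := by
  unfold deltaFun
  simp only [neg_eq_zero, neg_div, Real.sin_neg, Real.cos_neg]
  split_ifs
  · simp
  · rw [← neg_div]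
    congr 1 <;> ring

theorem mul_cos_lt_sin {k : ℝ} (h0 : 0 < k) (hπ : k < Real.pi) : k * Real.cos k < Real.sin k := by
  have hs : 0 < Real.sin k := Real.sin_pos_of_pos_of_lt_pi h0 hπ
  rcases lt_or_ge k (Real.pi / 2) with h | h
  · have hc : 0 < Real.cos k := Real.cos_pos_of_mem_Ioo ⟨by linarith, h⟩
    have := Real.lt_tan h0 h
    rwa [Real.tan_eq_sin_div_cos, lt_div_iff₀ hc] at this
  · have hc : Real.cos k ≤ 0 := Real.cos_nonpos_of_pi_div_two_le_of_le h (by linarith)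
    nlinarith

/-- The difference of the two sides vanishes at `0` and has derivative `sin s (3 sin s - 2 s cos
s)`, positive by `mul_cos_lt_sin`. It is the `m`-part of the derivative of `halfDeltaFun`. -/
theorem two_mul_sin_mul_cos_lt {k : ℝ} (h0 : 0 < k) (hπ : k < Real.pi) :
    2 * (Real.sin k * Real.cos k) < k * (1 + Real.cos k ^ 2) := by
  have hd : ∀ s, HasDerivAt
      (fun s => s * (1 + Real.cos s ^ 2) - 2 * (Real.sin s * Real.cos s))
      (Real.sin s * (3 * Real.sin s - 2 * (s * Real.cos s))) s := fun s => by
    refine (((hasDerivAt_id' s).fun_mul (((Real.hasDerivAt_cos s).fun_pow 2).const_add 1)).fun_sub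
      (((Real.hasDerivAt_sin s).fun_mul (Real.hasDerivAt_cos s)).const_mul 2)).congr_deriv ?_
    norm_num
    linear_combination (-1 : ℝ) * Real.sin_sq_add_cos_sq s
  have hmono : StrictMonoOn
      (fun s => s * (1 + Real.cos s ^ 2) - 2 * (Real.sin s * Real.cos s)) (Set.Ico 0 Real.pi) := by
    refine strictMonoOn_of_deriv_pos (convex_Ico 0 Real.pi)
      (fun s _ => (hd s).continuousAt.continuousWithinAt) fun s hs => ?_
    rw [interior_Ico] at hs
    rw [(hd s).deriv]
    have := mul_cos_lt_sin hs.1 hs.2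
    have := Real.sin_pos_of_pos_of_lt_pi hs.1 hs.2
    exact mul_pos this (by linarith)
  have := hmono (Set.left_mem_Ico.2 Real.pi_pos) ⟨h0.le, hπ⟩ h0
  norm_num at this
  linarith

theorem halfDeltaFun_pos {V m k : ℝ} (hV : 0 < V) (hm : 0 ≤ m) (h0 : 0 < k) (hπ : k < Real.pi) :
    0 < halfDeltaFun V m k := by
  have hs : 0 < Real.sin k := Real.sin_pos_of_pos_of_lt_pi h0 hπ
  have h1 := mul_cos_lt_sin h0 hπ
  have h2 : 0 < k - Real.sin k * Real.cos k := by
    have := Real.sin_lt (show 0 < 2 * k by linarith)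
    rw [Real.sin_two_mul] at this
    linarith
  refine div_pos (add_pos_of_pos_of_nonneg (mul_pos hV h2) ?_) (by positivity)
  exact mul_nonneg (by positivity) (by linarith)

theorem hasDerivAt_halfDeltaFun (V m : ℝ) {k : ℝ} (hs : Real.sin k ≠ 0) :
    HasDerivAt (halfDeltaFun V m)
      ((V * (2 * (Real.sin k - k * Real.cos k))
        + 2 * m * (k * (1 + Real.cos k ^ 2) - 2 * (Real.sin k * Real.cos k))) / Real.sin k ^ 3) k := by
  have hS := Real.hasDerivAt_sin k
  have hC := Real.hasDerivAt_cos k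
  have hI := hasDerivAt_id' k
  refine ((((hI.fun_sub (hS.fun_mul hC)).const_mul V).fun_add
    ((hS.fun_sub (hI.fun_mul hC)).const_mul (2 * m))).fun_div (hS.fun_pow 2)
    (pow_ne_zero 2 hs)).congr_deriv ?_
  norm_num
  rw [div_eq_div_iff (by positivity) (by positivity)]
  have hc2 : Real.cos k ^ 2 = 1 - Real.sin k ^ 2 := Real.cos_sq' k
  ring_nf
  simp only [hc2]
  ring

theorem strictMonoOn_halfDeltaFun {V m : ℝ} (hV : 0 < V) (hm : 0 ≤ m) :
    StrictMonoOn (halfDeltaFun V m) (Set.Ioo 0 Real.pi) := by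
  have hs : ∀ k ∈ Set.Ioo (0 : ℝ) Real.pi, 0 < Real.sin k := fun k hk =>
    Real.sin_pos_of_pos_of_lt_pi hk.1 hk.2
  refine strictMonoOn_of_deriv_pos (convex_Ioo 0 Real.pi) (fun k hk =>
    (hasDerivAt_halfDeltaFun V m (hs k hk).ne').continuousAt.continuousWithinAt) fun k hk => ?_
  rw [interior_Ioo] at hk
  rw [(hasDerivAt_halfDeltaFun V m (hs k hk).ne').deriv]
  have h1 := mul_cos_lt_sin hk.1 hk.2
  have h2 := two_mul_sin_mul_cos_lt hk.1 hk.2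
  refine div_pos (add_pos_of_pos_of_nonneg (mul_pos hV (by linarith)) ?_) (pow_pos (hs k hk) 3)
  exact mul_nonneg (by positivity) (by linarith)

/-- The numerator is of order `k³` against `sin² k ≥ k²/4`; this gives the limit `0` at `0` needed
for existence. -/
theorem halfDeltaFun_le_mul {V m k : ℝ} (hV : 0 < V) (hm : 0 ≤ m) (h0 : 0 < k) (h1 : k ≤ 1) :
    halfDeltaFun V m k ≤ (4 * V + 4 * m) * k := by
  have hs : k - k ^ 3 / 6 < Real.sin k := Real.sin_gt_sub_cube h0
  have hsk : Real.sin k ≤ k := Real.sin_le h0.le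
  have hc : 1 - k ^ 2 / 2 ≤ Real.cos k := Real.one_sub_sq_div_two_le_cos
  have hk2 : k ^ 2 ≤ 1 := by nlinarith
  have hhalf : k / 2 ≤ Real.sin k := by nlinarith
  have hc0 : 0 ≤ 1 - k ^ 2 / 2 := by linarith
  have hsc : k - k ^ 3 ≤ Real.sin k * Real.cos k := by
    have h1 : (k - k ^ 3 / 6) * (1 - k ^ 2 / 2) ≤ Real.sin k * Real.cos k :=
      mul_le_mul hs.le hc hc0 (by linarith)
    have h2 : 0 ≤ k ^ 3 * (1 + k ^ 2 / 4) := by positivity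
    nlinarith
  have hkc : k - k ^ 3 / 2 ≤ k * Real.cos k := by nlinarith
  have hsq : k ^ 2 / 4 ≤ Real.sin k ^ 2 := by nlinarith
  unfold halfDeltaFun
  rw [div_le_iff₀ (by nlinarith)]
  have hA : V * (k - Real.sin k * Real.cos k) ≤ V * k ^ 3 :=
    mul_le_mul_of_nonneg_left (by linarith) hV.le
  have hB : 2 * m * (Real.sin k - k * Real.cos k) ≤ 2 * m * (k ^ 3 / 2) :=
    mul_le_mul_of_nonneg_left (by linarith) (by linarith)
  have hC : (4 * V + 4 * m) * k * (k ^ 2 / 4) ≤ (4 * V + 4 * m) * k * Real.sin k ^ 2 :=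
    mul_le_mul_of_nonneg_left hsq (by positivity)
  nlinarith

/-- Blow-up at `π`: the numerator stays at least `V` because `π - h > 1`, while `sin h ≤ h`. -/
theorem div_sq_le_halfDeltaFun {V m h : ℝ} (hV : 0 < V) (hm : 0 ≤ m) (h0 : 0 < h) (h1 : h ≤ 1) :
    V / h ^ 2 ≤ halfDeltaFun V m (Real.pi - h) := by
  have hπ := Real.pi_gt_three
  have hs : 0 < Real.sin h := Real.sin_pos_of_pos_of_lt_pi h0 (by linarith)
  have hc : 0 < Real.cos h := Real.cos_pos_of_mem_Ioo ⟨by linarith, by linarith⟩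
  have hle : Real.sin h ≤ h := Real.sin_le h0.le
  unfold halfDeltaFun
  rw [Real.sin_pi_sub, Real.cos_pi_sub]
  refine div_le_div₀ ?_ ?_ (by positivity) (by gcongr)
  · have h1 : 0 < Real.sin h * Real.cos h := mul_pos hs hc
    have h2 : 0 < (Real.pi - h) * Real.cos h := mul_pos (by linarith) hc
    refine add_nonneg (mul_nonneg hV.le ?_) (mul_nonneg (by positivity) ?_) <;> linarith
  · have h1 : 0 < Real.sin h * Real.cos h := mul_pos hs hc
    have h2 : 0 < (Real.pi - h) * Real.cos h := mul_pos (by linarith) hc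
    have h3 : 0 ≤ 2 * m * (Real.sin h - (Real.pi - h) * -Real.cos h) :=
      mul_nonneg (by positivity) (by linarith)
    nlinarith

theorem exists_halfDeltaFun_eq {V m d : ℝ} (hV : 0 < V) (hm : 0 ≤ m) (hd : 0 < d) :
    ∃ k ∈ Set.Ioo 0 Real.pi, halfDeltaFun V m k = d := by
  have hπ := Real.pi_gt_three
  -- The linear bound puts the value at `a` below `d`; since `h² ≤ h ≤ V / d`, the blow-up puts the
  -- value at `π - h` above `d`.
  set a := min 1 (d / (4 * V + 4 * m)) with ha
  set h := min 1 (V / d) with hh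
  have ha0 : 0 < a := lt_min one_pos (by positivity)
  have hh0 : 0 < h := lt_min one_pos (by positivity)
  have ha1 : a ≤ 1 := min_le_left _ _
  have hh1 : h ≤ 1 := min_le_left _ _
  have hab : a ≤ Real.pi - h := by linarith
  have hlow : halfDeltaFun V m a ≤ d := by
    refine (halfDeltaFun_le_mul hV hm ha0 ha1).trans ?_
    have : a ≤ d / (4 * V + 4 * m) := min_le_right _ _
    rw [le_div_iff₀ (by positivity)] at this
    linarith
  have hupp : d ≤ halfDeltaFun V m (Real.pi - h) := by
    refine le_trans ?_ (div_sq_le_halfDeltaFun hV hm hh0 hh1)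
    have : h ≤ V / d := min_le_right _ _
    rw [le_div_iff₀ hd] at this
    rw [le_div_iff₀ (by positivity)]
    nlinarith
  have hcont : ContinuousOn (halfDeltaFun V m) (Set.Icc a (Real.pi - h)) := fun k hk =>
    (hasDerivAt_halfDeltaFun V m (Real.sin_pos_of_pos_of_lt_pi (by linarith [hk.1])
      (by linarith [hk.2])).ne').continuousAt.continuousWithinAt
  obtain ⟨k, hk, hkd⟩ := intermediate_value_Icc hab hcont ⟨hlow, hupp⟩
  exact ⟨k, ⟨by linarith [hk.1], by linarith [hk.2]⟩, hkd⟩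

theorem deltaFun_zero (v₀ v₁ : ℝ) : deltaFun v₀ v₁ 0 = 0 := by simp [deltaFun]

theorem strictMonoOn_deltaFun {v₀ v₁ : ℝ} (hV : 0 < v₁ + v₀) :
    StrictMonoOn (deltaFun v₀ v₁) (Set.Ioo (-(2 * Real.pi)) (2 * Real.pi)) := by
  have hm : 0 ≤ √(v₁ * v₀) := Real.sqrt_nonneg _
  have hpos : ∀ δ, 0 < δ → δ < 2 * Real.pi → 0 < deltaFun v₀ v₁ δ := fun δ h0 h1 => by
    rw [show δ = 2 * (δ / 2) by ring, deltaFun_two_mul v₀ v₁ (by positivity)]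
    exact halfDeltaFun_pos hV hm (by positivity) (by linarith)
  have hmono : ∀ a b, 0 < a → a < b → b < 2 * Real.pi → deltaFun v₀ v₁ a < deltaFun v₀ v₁ b :=
    fun a b h0 hab h1 => by
      have hb : 0 < b := h0.trans hab
      rw [show a = 2 * (a / 2) by ring, show b = 2 * (b / 2) by ring,
        deltaFun_two_mul v₀ v₁ (by positivity), deltaFun_two_mul v₀ v₁ (by positivity)]
      exact strictMonoOn_halfDeltaFun hV hm ⟨by positivity, by linarith⟩
        ⟨by positivity, by linarith⟩ (by linarith)
  have hneg : ∀ δ, δ < 0 → -(2 * Real.pi) < δ → deltaFun v₀ v₁ δ < 0 := fun δ h0 h1 => by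
    have := hpos (-δ) (by linarith) (by linarith)
    rw [deltaFun_neg] at this
    linarith
  intro a ha b hb hab
  rcases lt_trichotomy a 0 with h | rfl | h
  · rcases lt_trichotomy b 0 with h' | rfl | h'
    · have := hmono (-b) (-a) (by linarith) (by linarith) (by linarith [ha.1])
      rw [deltaFun_neg, deltaFun_neg] at this
      linarith
    · rw [deltaFun_zero]
      exact hneg a h ha.1
    · exact (hneg a h ha.1).trans (hpos b h' hb.2)
  · rw [deltaFun_zero]
    exact hpos b hab hb.2
  · exact hmono a b h hab hb.2

theorem exists_deltaFun_eq {v₀ v₁ : ℝ} (hV : 0 < v₁ + v₀) (d : ℝ) :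
    ∃ δ ∈ Set.Ioo (-(2 * Real.pi)) (2 * Real.pi), deltaFun v₀ v₁ δ = d := by
  have hπ := Real.pi_pos
  have hpos : ∀ d, 0 < d → ∃ δ ∈ Set.Ioo (-(2 * Real.pi)) (2 * Real.pi), deltaFun v₀ v₁ δ = d :=
    fun d hd => by
      obtain ⟨k, hk, hkd⟩ := exists_halfDeltaFun_eq hV (Real.sqrt_nonneg (v₁ * v₀)) hd
      exact ⟨2 * k, ⟨by linarith [hk.1], by linarith [hk.2]⟩,
        by rw [deltaFun_two_mul v₀ v₁ hk.1.ne', hkd]⟩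
  rcases lt_trichotomy d 0 with h | rfl | h
  · obtain ⟨δ, hδ, hδd⟩ := hpos (-d) (by linarith)
    exact ⟨-δ, ⟨by linarith [hδ.2], by linarith [hδ.1]⟩, by rw [deltaFun_neg, hδd, neg_neg]⟩
  · exact ⟨0, ⟨by linarith, by linarith⟩, deltaFun_zero v₀ v₁⟩
  · exact hpos d h

/-! ### Lower bounds and the values of the distances -/

/-- For horizontal `w` this is `√(a² + b² + ε²) ≤ √(a² + b²) + ε`; otherwise the right side is
infinite. It bounds the regularized length by the true length plus `ε`. -/
theorem ofReal_sqrt_le_grushinENorm_add (p w : ℝ × ℝ) {ε : ℝ} (hε : 0 < ε) :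
    ENNReal.ofReal √(w.1 ^ 2 / (p.2 ^ 2 + ε ^ 2) + 4 * w.2 ^ 2 + ε ^ 2) ≤
      grushinENorm p w + ENNReal.ofReal ε := by
  unfold grushinENorm
  simp only [ENNReal.iInf_add]
  refine le_iInf fun a => le_iInf fun b => le_iInf fun hw => ?_
  rw [← ENNReal.ofReal_add (Real.sqrt_nonneg _) hε.le]
  refine ENNReal.ofReal_le_ofReal (Real.sqrt_le_iff.2 ⟨by positivity, ?_⟩)
  have h1 : (a * p.2) ^ 2 / (p.2 ^ 2 + ε ^ 2) ≤ a ^ 2 := by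
    rw [div_le_iff₀ (by positivity)]
    nlinarith [sq_nonneg (a * ε)]
  have h2 : √(a ^ 2 + b ^ 2) ^ 2 = a ^ 2 + b ^ 2 := Real.sq_sqrt (by positivity)
  have h3 : 0 ≤ √(a ^ 2 + b ^ 2) * ε := by positivity
  rw [hw]
  simp only
  nlinarith

namespace IsGrushinGeodesic

variable {k : ℝ} {X Y Z : ℝ → ℝ}

theorem calibration_le_lintegral_grushinENorm (h : IsGrushinGeodesic k X Y Z)
    (hk : |k| < Real.pi) {γ : ℝ → ℝ × ℝ} (hγ : ContDiffOn ℝ 1 γ (Set.Icc 0 1))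
    (hfin : ∫⁻ t in Set.Icc (0 : ℝ) 1, grushinENorm (γ t) (derivWithin γ (Set.Icc 0 1) t) ≠ ∞) :
    4 * k * ((γ 1).1 - (γ 0).1) +
        (grushinCalibration k Y Z 1 (γ 1).2 - grushinCalibration k Y Z 0 (γ 0).2) ≤
      (∫⁻ t in Set.Icc (0 : ℝ) 1,
        grushinENorm (γ t) (derivWithin γ (Set.Icc 0 1) t)).toReal ^ 2 := by
  set γ' := derivWithin γ (Set.Icc 0 1) with hγ'
  set ℓ := ∫⁻ t in Set.Icc (0 : ℝ) 1, grushinENorm (γ t) (γ' t) with hℓ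
  have hc : ContinuousOn γ (Set.Icc 0 1) := hγ.continuousOn
  have hc' : ContinuousOn γ' (Set.Icc 0 1) :=
    hγ.continuousOn_derivWithin (uniqueDiffOn_Icc one_pos) le_rfl
  have hd : ∀ t ∈ Set.Ioo (0 : ℝ) 1, HasDerivAt γ (γ' t) t := fun t ht =>
    ((hγ.differentiableOn one_ne_zero) t ⟨ht.1.le, ht.2.le⟩).hasDerivWithinAt.hasDerivAt
      (Icc_mem_nhds ht.1 ht.2)
  have hbound : ∀ ε : ℝ, 0 < ε → 4 * k * ((γ 1).1 - (γ 0).1) +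
      (grushinCalibration k Y Z 1 (γ 1).2 - grushinCalibration k Y Z 0 (γ 0).2) ≤
      (ℓ.toReal + ε) ^ 2 + 4 * k ^ 2 * ε ^ 2 := fun ε hε => by
    refine (h.calibration_le hk hc.fst hc.snd hc'.fst hc'.snd
      (fun t ht => (hd t ht).fst) (fun t ht => (hd t ht).snd) hε).trans ?_
    gcongr
    · exact intervalIntegral.integral_nonneg zero_le_one fun t _ => Real.sqrt_nonneg _
    rw [intervalIntegral.integral_of_le zero_le_one, ← MeasureTheory.integral_Icc_eq_integral_Ioc,
      MeasureTheory.integral_eq_lintegral_of_nonneg_ae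
        (Filter.Eventually.of_forall fun t => Real.sqrt_nonneg _)]
    · rw [← ENNReal.toReal_ofReal hε.le, ← ENNReal.toReal_add hfin ENNReal.ofReal_ne_top,
        ENNReal.toReal_ofReal hε.le]
      refine ENNReal.toReal_mono (ENNReal.add_ne_top.2 ⟨hfin, ENNReal.ofReal_ne_top⟩) ?_
      refine (MeasureTheory.lintegral_mono fun t =>
        ofReal_sqrt_le_grushinENorm_add (γ t) (γ' t) hε).trans ?_
      rw [MeasureTheory.lintegral_add_right _ measurable_const]
      simp [hℓ]
    · refine ContinuousOn.aestronglyMeasurable (ContinuousOn.sqrt ((((hc'.fst.pow 2).div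
        ((hc.snd.pow 2).add continuousOn_const) ?_).add
        (continuousOn_const.mul (hc'.snd.pow 2))).add continuousOn_const)) measurableSet_Icc
      exact fun t _ => (add_pos_of_nonneg_of_pos (sq_nonneg _) (pow_pos hε 2)).ne'
  have hlim : Filter.Tendsto (fun ε : ℝ => (ℓ.toReal + ε) ^ 2 + 4 * k ^ 2 * ε ^ 2)
      (nhdsWithin 0 (Set.Ioi 0)) (nhds (ℓ.toReal ^ 2)) := by
    have : Continuous fun ε : ℝ => (ℓ.toReal + ε) ^ 2 + 4 * k ^ 2 * ε ^ 2 := by fun_prop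
    simpa using (this.tendsto 0).mono_left nhdsWithin_le_nhds
  exact ge_of_tendsto hlim (Filter.eventually_of_mem self_mem_nhdsWithin hbound)

theorem calibration_eq (h : IsGrushinGeodesic k X Y Z) :
    4 * k * (X 1 - X 0) +
        (grushinCalibration k Y Z 1 (Y 1) - grushinCalibration k Y Z 0 (Y 0)) =
      4 * (Z 0 ^ 2 + k ^ 2 * Y 0 ^ 2) := by
  rw [grushinCalibration_self, grushinCalibration_self, ← h.action_eq]
  ring

theorem ofReal_le_of_sq_le {C : ℝ} {ℓ : ℝ≥0∞}
    (h : ℓ ≠ ∞ → 4 * C ≤ ℓ.toReal ^ 2) : ENNReal.ofReal (2 * √C) ≤ ℓ := by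
  rcases eq_or_ne ℓ ∞ with rfl | hfin
  · exact le_top
  rw [ENNReal.ofReal_le_iff_le_toReal hfin]
  have : √(4 * C) ≤ ℓ.toReal := Real.sqrt_le_iff.2 ⟨ENNReal.toReal_nonneg, h hfin⟩
  rwa [Real.sqrt_mul (by norm_num), show (4 : ℝ) = 2 ^ 2 by norm_num,
    Real.sqrt_sq (by norm_num)] at this

theorem grushinEDist_eq (h : IsGrushinGeodesic k X Y Z) (hk : |k| < Real.pi) :
    grushinEDist (X 0, Y 0) (X 1, Y 1) =
      ENNReal.ofReal (2 * √(Z 0 ^ 2 + k ^ 2 * Y 0 ^ 2)) := by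
  refine le_antisymm h.grushinEDist_le (le_iInf₂ fun γ ⟨hγ, h0, h1⟩ => ?_)
  refine ofReal_le_of_sq_le fun hfin => ?_
  have := h.calibration_le_lintegral_grushinENorm hk hγ hfin
  rwa [h0, h1, h.calibration_eq] at this

/-- Regularizing the square root turns a Heston curve into a Grushin curve that is not longer. -/
theorem lintegral_grushinENorm_sqrt_le {A B : ℝ × ℝ} {γ : ℝ → ℝ × ℝ} (hγ : IsHestonCurve A B γ)
    {ε : ℝ} (hε : 0 < ε) :
    ContDiffOn ℝ 1 (fun t => ((γ t).1, √((γ t).2 + ε))) (Set.Icc 0 1) ∧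
    ∫⁻ t in Set.Icc (0 : ℝ) 1, grushinENorm ((γ t).1, √((γ t).2 + ε))
      (derivWithin (fun t => ((γ t).1, √((γ t).2 + ε))) (Set.Icc 0 1) t) ≤ hestonLength γ := by
  have hnn : ∀ t ∈ Set.Icc (0 : ℝ) 1, 0 ≤ (γ t).2 := by
    have hcl : IsClosed (Set.Icc (0 : ℝ) 1 ∩ (fun t => (γ t).2) ⁻¹' Set.Ici 0) :=
      hγ.contDiffOn.continuousOn.snd.preimage_isClosed_of_isClosed isClosed_Icc isClosed_Ici
    have hsub : Set.Ioo (0 : ℝ) 1 ⊆ Set.Icc (0 : ℝ) 1 ∩ (fun t => (γ t).2) ⁻¹' Set.Ici 0 :=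
      fun t ht => ⟨⟨ht.1.le, ht.2.le⟩, (hγ.interior t ht).le⟩
    have := hcl.closure_subset_iff.2 hsub
    rw [closure_Ioo zero_ne_one] at this
    exact fun t ht => (this ht).2
  refine ⟨hγ.contDiffOn.fst.prodMk ((hγ.contDiffOn.snd.add contDiffOn_const).sqrt
    fun t ht => ?_), ?_⟩
  · exact (add_pos_of_nonneg_of_pos (hnn t ht) hε).ne'
  unfold hestonLength
  -- The end points may have `v = 0`, where the Heston integrand is a default value; they form a
  -- null set.
  rw [MeasureTheory.Measure.restrict_congr_set MeasureTheory.Ioo_ae_eq_Icc.symm]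
  refine MeasureTheory.setLIntegral_mono' measurableSet_Ioo fun t ht => ?_
  have hv := hγ.interior t ht
  have htI : t ∈ Set.Icc (0 : ℝ) 1 := ⟨ht.1.le, ht.2.le⟩
  have hd := ((hγ.contDiffOn.differentiableOn one_ne_zero) t htI).hasDerivWithinAt
  set w := derivWithin γ (Set.Icc 0 1) t
  have hd₁ : HasDerivWithinAt (fun s => (γ s).1) w.1 (Set.Icc 0 1) t := hd.fst
  have hd₂ : HasDerivWithinAt (fun s => (γ s).2) w.2 (Set.Icc 0 1) t := hd.snd
  have hpos : 0 < (γ t).2 + ε := by positivity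
  rw [(hd₁.prodMk ((hd₂.add_const ε).sqrt hpos.ne')).derivWithin
    (uniqueDiffOn_Icc one_pos t htI)]
  have hs : 0 < √((γ t).2 + ε) := Real.sqrt_pos.2 hpos
  -- These frame coefficients have squared norm `(w.1² + w.2²) / (v + ε)`, at most the squared
  -- Heston speed.
  refine (iInf₂_le (w.1 / √((γ t).2 + ε)) (w.2 / √((γ t).2 + ε))).trans
    ((iInf_le _ ?_).trans (ENNReal.ofReal_le_ofReal (Real.sqrt_le_sqrt ?_)))
  · ext <;> simp <;> field_simp
  · rw [div_pow, div_pow, Real.sq_sqrt hpos.le, ← add_div]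
    gcongr
    linarith

theorem hestonEDist_eq (h : IsGrushinGeodesic k X Y Z) (hk : |k| < Real.pi)
    (hY : ∀ t ∈ Set.Ioo (0 : ℝ) 1, 0 < Y t) (hY0 : 0 ≤ Y 0) (hY1 : 0 ≤ Y 1) :
    hestonEDist (X 0, Y 0 ^ 2) (X 1, Y 1 ^ 2) =
      ENNReal.ofReal (2 * √(Z 0 ^ 2 + k ^ 2 * Y 0 ^ 2)) := by
  refine le_antisymm (h.hestonEDist_le hY) (le_iInf₂ fun γ hγ => ?_)
  refine ofReal_le_of_sq_le fun hfin => ?_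
  -- The regularized curve ends at the shifted heights `√(Y² + ε)`, so the calibration is evaluated
  -- there and continuity recovers the true end points.
  have hbound : ∀ ε : ℝ, 0 < ε → 4 * k * (X 1 - X 0) +
      (grushinCalibration k Y Z 1 √(Y 1 ^ 2 + ε) - grushinCalibration k Y Z 0 √(Y 0 ^ 2 + ε)) ≤
      (hestonLength γ).toReal ^ 2 := fun ε hε => by
    obtain ⟨hc, hle⟩ := lintegral_grushinENorm_sqrt_le hγ hε
    have := h.calibration_le_lintegral_grushinENorm hk hc (ne_top_of_le_ne_top hfin hle)
    simp only [hγ.source, hγ.target] at this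
    refine this.trans ?_
    gcongr
  have hlim : Filter.Tendsto (fun ε : ℝ => 4 * k * (X 1 - X 0) +
      (grushinCalibration k Y Z 1 √(Y 1 ^ 2 + ε) - grushinCalibration k Y Z 0 √(Y 0 ^ 2 + ε)))
      (nhdsWithin 0 (Set.Ioi 0)) (nhds (4 * (Z 0 ^ 2 + k ^ 2 * Y 0 ^ 2))) := by
    have hs : ∀ a : ℝ, Continuous fun ε : ℝ => √(a ^ 2 + ε) := fun a =>
      (continuous_const.add continuous_id).sqrt
    have : Continuous (fun ε : ℝ => 4 * k * (X 1 - X 0) +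
        (grushinCalibration k Y Z 1 √(Y 1 ^ 2 + ε)
          - grushinCalibration k Y Z 0 √(Y 0 ^ 2 + ε))) :=
      continuous_const.add (((continuous_grushinCalibration k Y Z 1).comp (hs (Y 1))).sub
        ((continuous_grushinCalibration k Y Z 0).comp (hs (Y 0))))
    have := (this.tendsto 0).mono_left (nhdsWithin_le_nhds (s := Set.Ioi 0))
    simpa only [add_zero, Real.sqrt_sq hY0, Real.sqrt_sq hY1, h.calibration_eq] using this
  exact le_of_tendsto hlim (Filter.eventually_of_mem self_mem_nhdsWithin hbound)

end IsGrushinGeodesic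

/-! ### The explicit geodesic between two points -/

theorem sin_mul_div_sin_pos {k t : ℝ} (hk : |k| < Real.pi) (hk0 : k ≠ 0)
    (ht : t ∈ Set.Ioc (0 : ℝ) 1) : 0 < Real.sin (k * t) / Real.sin k := by
  have key : ∀ k : ℝ, 0 < k → k < Real.pi → 0 < Real.sin (k * t) / Real.sin k := fun k h0 h1 =>
    div_pos (Real.sin_pos_of_pos_of_lt_pi (mul_pos h0 ht.1)
      (by nlinarith [ht.2])) (Real.sin_pos_of_pos_of_lt_pi h0 h1)
  have h := abs_lt.1 hk
  rcases lt_or_gt_of_ne hk0 with hneg | hpos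
  · have := key (-k) (by linarith) (by linarith)
    rwa [neg_mul, Real.sin_neg, Real.sin_neg, neg_div_neg_eq] at this
  · exact key k hpos h.2

/-- Two points of the half-plane `y ≥ 0`, not both on its boundary, are joined by a geodesic that
runs in the interior. -/
theorem exists_isGrushinGeodesic {δ : ℝ}
    (hδ : δ ∈ Set.Ioo (-(2 * Real.pi)) (2 * Real.pi)) {y₀ y₁ : ℝ} (hy₀ : 0 ≤ y₀) (hy₁ : 0 ≤ y₁)
    (hy : ¬ (y₀ = 0 ∧ y₁ = 0)) (x₀ : ℝ) :
    ∃ X Y Z : ℝ → ℝ, IsGrushinGeodesic (δ / 2) X Y Z ∧ X 0 = x₀ ∧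
      X 1 = x₀ + deltaFun (y₀ ^ 2) (y₁ ^ 2) δ ∧ Y 0 = y₀ ∧ Y 1 = y₁ ∧
      (∀ t ∈ Set.Ioo (0 : ℝ) 1, 0 < Y t) ∧
      2 * √(Z 0 ^ 2 + (δ / 2) ^ 2 * Y 0 ^ 2) =
        deltaFactor δ * √(y₁ ^ 2 + y₀ ^ 2 - 2 * (y₀ * y₁) * Real.cos (δ / 2)) := by
  have hcomb : ∀ a b : ℝ, 0 < a → 0 < b → 0 < y₀ * a + y₁ * b := fun a b ha hb => by
    rcases hy₀.eq_or_lt with h | h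
    · have : 0 < y₁ := hy₁.lt_of_ne fun h' => hy ⟨h.symm, h'.symm⟩
      positivity
    · positivity
  rcases eq_or_ne δ 0 with rfl | hδ0
  · refine ⟨fun _ => x₀, fun t => y₀ * (1 - t) + y₁ * t, fun _ => y₁ - y₀,
      ⟨fun t => ?_, fun t => ?_, fun t => ?_⟩, rfl, by simp [deltaFun], by simp, by simp,
      fun t ht => hcomb _ _ (by linarith [ht.2]) ht.1, ?_⟩
    · simpa using hasDerivAt_const t x₀
    · refine ((((hasDerivAt_id' t).const_sub 1).const_mul y₀).fun_add
        ((hasDerivAt_id' t).const_mul y₁)).congr_deriv ?_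
      ring
    · simpa using hasDerivAt_const t (y₁ - y₀)
    · simp only [deltaFactor, if_true, zero_div, Real.cos_zero]
      congr 2
      ring
  obtain ⟨k, rfl⟩ : ∃ k, δ = 2 * k := ⟨δ / 2, by ring⟩
  have hk0 : k ≠ 0 := by simpa using hδ0
  have hk : |k| < Real.pi := abs_lt.2 ⟨by linarith [hδ.1], by linarith [hδ.2]⟩
  have hs : Real.sin k ≠ 0 := fun h0 => by
    have := sin_mul_div_sin_pos hk hk0 (Set.right_mem_Ioc.2 one_pos)
    simp [h0] at this
  rw [show 2 * k / 2 = k by ring]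
  -- The solution of `Y'' = -k² Y` with boundary values `y₀, y₁`; both coefficients are positive
  -- inside since `|k| < π`.
  set Y : ℝ → ℝ := fun t =>
    y₀ * (Real.sin (k * (1 - t)) / Real.sin k) + y₁ * (Real.sin (k * t) / Real.sin k) with hYdef
  set Z : ℝ → ℝ := fun t =>
    k * (y₁ * Real.cos (k * t) - y₀ * Real.cos (k * (1 - t))) / Real.sin k with hZdef
  set C := k ^ 2 * (y₁ ^ 2 + y₀ ^ 2 - 2 * (y₀ * y₁) * Real.cos k) / Real.sin k ^ 2 with hC
  have hl : ∀ t : ℝ, HasDerivAt (fun t : ℝ => k * t) k t := fun t =>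
    ((hasDerivAt_id' t).const_mul k).congr_deriv (mul_one k)
  have hr : ∀ t : ℝ, HasDerivAt (fun t : ℝ => k * (1 - t)) (-k) t := fun t =>
    (((hasDerivAt_id' t).const_sub 1).const_mul k).congr_deriv (by ring)
  have hYd : ∀ t, HasDerivAt Y (Z t) t := fun t => by
    refine ((((hr t).sin.div_const (Real.sin k)).const_mul y₀).fun_add
      (((hl t).sin.div_const (Real.sin k)).const_mul y₁)).congr_deriv ?_
    rw [hZdef]
    ring
  have hZd : ∀ t, HasDerivAt Z (-k ^ 2 * Y t) t := fun t => by
    refine (((((hl t).cos.const_mul y₁).fun_sub ((hr t).cos.const_mul y₀)).const_mul k).div_const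
      (Real.sin k)).congr_deriv ?_
    rw [hYdef]
    ring
  have hY0 : Y 0 = y₀ := by simp [hYdef, hs]
  have hY1 : Y 1 = y₁ := by simp [hYdef, hs]
  have hZ0 : Z 0 = k * (y₁ - y₀ * Real.cos k) / Real.sin k := by simp [hZdef]
  have hZ1 : Z 1 = k * (y₁ * Real.cos k - y₀) / Real.sin k := by simp [hZdef]
  have hsc := Real.sin_sq_add_cos_sq k
  have hCZ : Z 0 ^ 2 + k ^ 2 * Y 0 ^ 2 = C := by
    rw [hZ0, hY0, hC]
    field_simp
    linear_combination y₀ ^ 2 * hsc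
  have hCt : ∀ t, Z t ^ 2 + k ^ 2 * Y t ^ 2 = C := fun t =>
    (harmonic_energy_eq hYd hZd t).trans hCZ
  -- This is the integral of `2kY²`: energy conservation gives `2k²Y² = C - (YZ)'`.
  refine ⟨fun t => x₀ + (C * t - (Y t * Z t - Y 0 * Z 0)) / k, Y, Z,
    ⟨fun t => ?_, hYd, hZd⟩, by simp, ?_, hY0, hY1, fun t ht => ?_, ?_⟩
  · refine ((((hasDerivAt_id' t).const_mul C).fun_sub
      (((hYd t).fun_mul (hZd t)).sub_const (Y 0 * Z 0))).div_const k |>.const_add x₀).congr_deriv ?_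
    rw [← hCt t]
    field_simp
    ring
  · beta_reduce
    rw [deltaFun_two_mul _ _ hk0, hY0, hY1, hZ0, hZ1, hC, ← mul_pow,
      Real.sqrt_sq (mul_nonneg hy₁ hy₀), halfDeltaFun]
    congr 1
    field_simp
    ring
  · refine hcomb _ _ (sin_mul_div_sin_pos hk hk0 ⟨by linarith [ht.2], by linarith [ht.1]⟩)
      (sin_mul_div_sin_pos hk hk0 ⟨ht.1, ht.2.le⟩)
  · have hpos : 0 ≤ k / Real.sin k := by
      rcases lt_or_gt_of_ne hk0 with hneg | hpos
      · exact div_nonneg_of_nonpos hneg.le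
          (Real.sin_nonpos_of_nonpos_of_neg_pi_le hneg.le (abs_lt.1 hk).1.le)
      · exact div_nonneg hpos.le (Real.sin_nonneg_of_nonneg_of_le_pi hpos.le (abs_lt.1 hk).2.le)
    rw [hCZ, hC, mul_div_right_comm, ← div_pow, Real.sqrt_mul (sq_nonneg _), Real.sqrt_sq hpos,
      deltaFactor, if_neg hδ0, show 2 * k / 2 = k by ring]
    ring

/-! ### The main theorem -/

theorem theorem3p1 (x₀ v₀ x₁ v₁ : ℝ)
    (h₀ : (x₀, v₀) ∈ hestonHalfPlane) (h₁ : (x₁, v₁) ∈ hestonHalfPlane)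
    (hv : ¬ (v₀ = 0 ∧ v₁ = 0)) :
    ∃ δ : ℝ,
      (δ ∈ Set.Ioo (-(2 * Real.pi)) (2 * Real.pi) ∧ deltaFun v₀ v₁ δ = x₁ - x₀) ∧
      (∀ δ' ∈ Set.Ioo (-(2 * Real.pi)) (2 * Real.pi),
        deltaFun v₀ v₁ δ' = x₁ - x₀ → δ' = δ) ∧
      hestonEDist (x₀, v₀) (x₁, v₁) ≠ ∞ ∧
      hestonDist (x₀, v₀) (x₁, v₁) =
        deltaFactor δ *
          Real.sqrt (v₁ + v₀ - 2 * Real.sqrt (v₀ * v₁) * Real.cos (δ / 2)) ∧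
      grushinEDist (x₀, Real.sqrt v₀) (x₁, Real.sqrt v₁) =
        hestonEDist (x₀, v₀) (x₁, v₁) := by
  have hv₀ : 0 ≤ v₀ := h₀
  have hv₁ : 0 ≤ v₁ := h₁
  have hV : 0 < v₁ + v₀ := (add_nonneg hv₁ hv₀).lt_of_ne fun h =>
    hv ⟨by linarith, by linarith⟩
  obtain ⟨δ, hδ, hδx⟩ := exists_deltaFun_eq hV (x₁ - x₀)
  refine ⟨δ, ⟨hδ, hδx⟩, fun δ' hδ' h' =>
    (strictMonoOn_deltaFun hV).injOn hδ' hδ (h'.trans hδx.symm), ?_⟩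
  obtain ⟨X, Y, Z, hgeo, hX0, hX1, hY0, hY1, hYpos, hlen⟩ := exists_isGrushinGeodesic hδ
    (Real.sqrt_nonneg v₀) (Real.sqrt_nonneg v₁)
    (by rwa [Real.sqrt_eq_zero hv₀, Real.sqrt_eq_zero hv₁]) x₀
  rw [Real.sq_sqrt hv₀, Real.sq_sqrt hv₁] at hX1 hlen
  rw [hδx, add_sub_cancel] at hX1
  have hk : |δ / 2| < Real.pi := abs_lt.2 ⟨by linarith [hδ.1], by linarith [hδ.2]⟩
  have hG := hgeo.grushinEDist_eq hk
  have hH := hgeo.hestonEDist_eq hk hYpos (hY0 ▸ Real.sqrt_nonneg _) (hY1 ▸ Real.sqrt_nonneg _)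
  have hnn : 0 ≤ 2 * √(Z 0 ^ 2 + (δ / 2) ^ 2 * Y 0 ^ 2) := by positivity
  rw [hX0, hX1, hY0, hY1, ← hY0, hlen, hY0] at hG
  rw [hX0, hX1, hlen, hY0, hY1, Real.sq_sqrt hv₀, Real.sq_sqrt hv₁] at hH
  rw [hlen] at hnn
  refine ⟨hH ▸ ENNReal.ofReal_ne_top, ?_, hG.trans hH.symm⟩
  rw [hestonDist, hH, ENNReal.toReal_ofReal hnn, Real.sqrt_mul hv₀]
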